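/- Let $m,n\ge 1$, let $f=(f_1,\dots,f_m)\colon\mathbb{R}^n\to\mathbb{R}^m$ be locally Lipschitz, let $\Omega\subset\mathbb{R}^n$ be nonempty and closed, and let $\|\cdot\|$ be the Euclidean norm. Notation. For $x\in\Omega$ (and likewise for closed sets in other Euclidean spaces) $\widehat N(x;\Omega)$ is the set of $v$ with $\limsup_{u\to x,\,u\in\Omega\setminus\{x\}}\langle v,u-x\rangle/\|u-x\|\le 0$ (all $v$ if $x$ is isolated in $\Omega$), and the limiting normal cone $N(x;\Omega)$ is the set of all limits of sequences $v^k\in\widehat N(x^k;\Omega)$ with $x^k\in\Omega$, $x^k\to x$. For $\phi\colon\mathbb{R}^n\to\mathbb{R}$ the limiting subdifferential is $\partial\phi(x)=\{v : (v,-1)\in N((x,\phi(x));\operatorname{epi}\phi)\}$. Put $$\nu(x)=\inf\Big\{\Big\|\sum_{i=1}^m\lambda_iv^i+w\Big\| : v^i\in\partial f_i(x)\cup\partial(-f_i)(x),\ w\in N(x;\Omega),\ \lambda\in\mathbb{R}^m_+,\ \sum_{i=1}^m\lambda_i=1\Big\},$$ and let $\Gamma(f,\Omega)$ be the set of $x\in\Omega$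 for which there are $v^i\in\partial f_i(x)\cup\partial(-f_i)(x)$ and $(\lambda,\mu)\in\mathbb{R}^m_+\times\mathbb{R}$ with $\sum_i\lambda_i+|\mu|=1$ and $0\in\sum_i\lambda_iv^i+\mu x+N(x;\Omega)$. For $Y\subset\mathbb{R}^m$ the recession cone is $$[Y]^\oplus=\{d\in\mathbb{R}^m : \exists\, t_k\ge 0,\ y^k\in Y \text{ with } t_k\to 0,\ t_ky^k\to d\}.$$ Inequalities $\leqq$ between vectors are componentwise. Assume that $[f(\Omega)]^\oplus\cap(-\mathbb{R}^m_+)=\{0\}$. Then the following conditions are equivalent: (i) $f|_\Omega$ is proper: for every $y\in\mathbb{R}^m$ and every sequence $\{x^k\}\subset\Omega$ with $\|x^k\|\to\infty$ and $f(x^k)\leqq y$ for all $k$, one has $\|f(x^k)\|\to\infty$; (ii) $f|_\Omega$ satisfies the Palais--Smale condition: there is no sequence $\{x^k\}\subset\Omega$ such that $\|x^k\|\to\infty$, $f(x^k)$ converges in $\mathbb{R}^m$, and $\nu(x^k)\to 0$; (iii) $f|_\Omega$ satisfies the weak Palais--Smale condition: there is no sequence $\{x^k\}\subset\Omega$ such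 that $\|x^k\|\to\infty$, $f(x^k)$ converges in $\mathbb{R}^m$, and $\|x^k\|\,\nu(x^k)\to 0$; (iv) $f|_\Omega$ is M-tame: there is no sequence $\{x^k\}\subset\Gamma(f,\Omega)$ such that $\|x^k\|\to\infty$ and $f(x^k)$ converges in $\mathbb{R}^m$. Moreover, each of these conditions implies that the problem of minimizing $f$ over $\Omega$ with respect to $\mathbb{R}^m_+$ has a Geoffrion-properly efficient solution, i.e. a point $\bar x\in\Omega$ such that there is no $x\in\Omega$ with $f(x)\leqq f(\bar x)$ and $f(x)\ne f(\bar x)$, and there is $M>0$ such that whenever $i\in\{1,\dots,m\}$ and $x\in\Omega$ satisfy $f_i(x)<f_i(\bar x)$, there is $j\in\{1,\dots,m\}$ with $f_j(\bar x)<f_j(x)$ and $\dfrac{f_i(\bar x)-f_i(x)}{f_j(x)-f_j(\bar x)}\le M$. -/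

import Mathlib

open Filter Topology
open scoped Pointwise ENNReal

namespace VectorOpt

noncomputable section

/-- The regular (Fréchet) normal cone to `S` at `x`: all `v` with
`⟪v, u - x⟫ ≤ o(‖u - x‖)` as `u → x`, `u ∈ S`. -/
def regularNormalCone {E : Type*} [NormedAddCommGroup E] [InnerProductSpace ℝ E]
    (S : Set E) (x : E) : Set E :=
  {v | ∀ ε : ℝ, 0 < ε → ∀ᶠ u in 𝓝[S] x, inner ℝ v (u - x) ≤ ε * ‖u - x‖}

/-- The limiting (Mordukhovich) normal cone to `S` at `x`. -/
def limitingNormalCone {E : Type*} [NormedAddCommGroup E] [InnerProductSpace ℝ E]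
    (S : Set E) (x : E) : Set E :=
  {v | ∃ (u : ℕ → E) (w : ℕ → E), (∀ k, u k ∈ S) ∧ Tendsto u atTop (𝓝 x) ∧
    (∀ k, w k ∈ regularNormalCone S (u k)) ∧ Tendsto w atTop (𝓝 v)}

/-- The epigraph of `φ`, in `E × ℝ` with the Euclidean product structure. -/
def epigraph {E : Type*} (φ : E → ℝ) : Set (WithLp 2 (E × ℝ)) :=
  {p | φ p.fst ≤ p.snd}

/-- The limiting subdifferential: `v ∈ ∂φ(x)` iff `(v, -1)` is a limiting normal to the
epigraph of `φ` at `(x, φ x)`. -/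
def subdifferential {E : Type*} [NormedAddCommGroup E] [InnerProductSpace ℝ E]
    (φ : E → ℝ) (x : E) : Set E :=
  {v | WithLp.toLp 2 (v, (-1 : ℝ)) ∈
    limitingNormalCone (epigraph φ) (WithLp.toLp 2 (x, φ x))}

/-- The symmetric set `∂f_i(x) ∪ ∂(-f_i)(x)`. -/
def symSubdifferential {n m : ℕ} (f : EuclideanSpace ℝ (Fin n) → EuclideanSpace ℝ (Fin m))
    (i : Fin m) (x : EuclideanSpace ℝ (Fin n)) : Set (EuclideanSpace ℝ (Fin n)) :=
  subdifferential (fun u => f u i) x ∪ subdifferential (fun u => -(f u i)) x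

/-- The nonnegative orthant `ℝ^m_+`. -/
def nonnegOrthant (m : ℕ) : Set (EuclideanSpace ℝ (Fin m)) :=
  {y | ∀ i, 0 ≤ y i}

/-- The recession cone `[Y]^⊕`. -/
def recessionCone {m : ℕ} (Y : Set (EuclideanSpace ℝ (Fin m))) :
    Set (EuclideanSpace ℝ (Fin m)) :=
  {d | ∃ (t : ℕ → ℝ) (y : ℕ → EuclideanSpace ℝ (Fin m)),
    (∀ k, 0 ≤ t k) ∧ (∀ k, y k ∈ Y) ∧ Tendsto t atTop (𝓝 0) ∧
      Tendsto (fun k => t k • y k) atTop (𝓝 d)}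

/-- `x̄` is a Pareto efficient solution of minimizing `f` over `Ω` with respect to `ℝ^m_+`. -/
def IsParetoEfficient {n m : ℕ} (f : EuclideanSpace ℝ (Fin n) → EuclideanSpace ℝ (Fin m))
    (Ω : Set (EuclideanSpace ℝ (Fin n))) (xbar : EuclideanSpace ℝ (Fin n)) : Prop :=
  xbar ∈ Ω ∧ ¬ ∃ x ∈ Ω, (∀ i, f x i ≤ f xbar i) ∧ f x ≠ f xbar

/-- `x̄` is a Geoffrion-properly efficient solution of minimizing `f` over `Ω`. -/
def IsGeoffrionProperlyEfficient {n m : ℕ}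
    (f : EuclideanSpace ℝ (Fin n) → EuclideanSpace ℝ (Fin m))
    (Ω : Set (EuclideanSpace ℝ (Fin n))) (xbar : EuclideanSpace ℝ (Fin n)) : Prop :=
  IsParetoEfficient f Ω xbar ∧
    ∃ M : ℝ, 0 < M ∧ ∀ i : Fin m, ∀ x ∈ Ω, f x i < f xbar i →
      ∃ j : Fin m, f xbar j < f x j ∧ (f xbar i - f x i) / (f x j - f xbar j) ≤ M

/-- `f|_Ω` is proper at the sublevel `y`. -/
def IsProperAtSublevel {n m : ℕ} (f : EuclideanSpace ℝ (Fin n) → EuclideanSpace ℝ (Fin m))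
    (Ω : Set (EuclideanSpace ℝ (Fin n))) (y : EuclideanSpace ℝ (Fin m)) : Prop :=
  ∀ x : ℕ → EuclideanSpace ℝ (Fin n), (∀ k, x k ∈ Ω) →
    Tendsto (fun k => ‖x k‖) atTop atTop → (∀ k i, f (x k) i ≤ y i) →
      Tendsto (fun k => ‖f (x k)‖) atTop atTop

/-- `f|_Ω` is proper: proper at every sublevel. -/
def IsProperOn {n m : ℕ} (f : EuclideanSpace ℝ (Fin n) → EuclideanSpace ℝ (Fin m))
    (Ω : Set (EuclideanSpace ℝ (Fin n))) : Prop :=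
  ∀ y, IsProperAtSublevel f Ω y

/-- The (extended) Rabier function `ν`; the infimum of the empty set is `∞`. -/
def rabier {n m : ℕ} (f : EuclideanSpace ℝ (Fin n) → EuclideanSpace ℝ (Fin m))
    (Ω : Set (EuclideanSpace ℝ (Fin n))) (x : EuclideanSpace ℝ (Fin n)) : ℝ≥0∞ :=
  sInf {r | ∃ (c : Fin m → ℝ) (v : Fin m → EuclideanSpace ℝ (Fin n))
      (w : EuclideanSpace ℝ (Fin n)),
    (∀ i, v i ∈ symSubdifferential f i x) ∧ w ∈ limitingNormalCone Ω x ∧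
      (∀ i, 0 ≤ c i) ∧ ∑ i, c i = 1 ∧ r = ‖(∑ i, c i • v i) + w‖ₑ}

/-- The set `K̃_{∞,≤ȳ}(f,Ω)`, for `ȳ ∈ (ℝ ∪ {∞})^m`. -/
def KTildeInfty {n m : ℕ} (f : EuclideanSpace ℝ (Fin n) → EuclideanSpace ℝ (Fin m))
    (Ω : Set (EuclideanSpace ℝ (Fin n))) (ybar : Fin m → WithTop ℝ) :
    Set (EuclideanSpace ℝ (Fin m)) :=
  {y | ∃ x : ℕ → EuclideanSpace ℝ (Fin n), (∀ k, x k ∈ Ω) ∧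
    (∀ k i, ((f (x k) i : ℝ) : WithTop ℝ) ≤ ybar i) ∧
    Tendsto (fun k => ‖x k‖) atTop atTop ∧ Tendsto (fun k => f (x k)) atTop (𝓝 y) ∧
    Tendsto (fun k => rabier f Ω (x k)) atTop (𝓝 0)}

/-- The set `K_{∞,≤ȳ}(f,Ω)`, for `ȳ ∈ (ℝ ∪ {∞})^m`. -/
def KInfty {n m : ℕ} (f : EuclideanSpace ℝ (Fin n) → EuclideanSpace ℝ (Fin m))
    (Ω : Set (EuclideanSpace ℝ (Fin n))) (ybar : Fin m → WithTop ℝ) :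
    Set (EuclideanSpace ℝ (Fin m)) :=
  {y | ∃ x : ℕ → EuclideanSpace ℝ (Fin n), (∀ k, x k ∈ Ω) ∧
    (∀ k i, ((f (x k) i : ℝ) : WithTop ℝ) ≤ ybar i) ∧
    Tendsto (fun k => ‖x k‖) atTop atTop ∧ Tendsto (fun k => f (x k)) atTop (𝓝 y) ∧
    Tendsto (fun k => ‖x k‖ₑ * rabier f Ω (x k)) atTop (𝓝 0)}

/-- The set `Γ(f,Ω)`. -/
def tangencySet {n m : ℕ} (f : EuclideanSpace ℝ (Fin n) → EuclideanSpace ℝ (Fin m))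
    (Ω : Set (EuclideanSpace ℝ (Fin n))) : Set (EuclideanSpace ℝ (Fin n)) :=
  {x | x ∈ Ω ∧ ∃ (v : Fin m → EuclideanSpace ℝ (Fin n)) (c : Fin m → ℝ) (μ : ℝ)
      (w : EuclideanSpace ℝ (Fin n)),
    (∀ i, v i ∈ symSubdifferential f i x) ∧ (∀ i, 0 ≤ c i) ∧ (∑ i, c i) + |μ| = 1 ∧
      w ∈ limitingNormalCone Ω x ∧ 0 = (∑ i, c i • v i) + μ • x + w}

/-- The set `T_{∞,≤ȳ}(f,Ω)`, for `ȳ ∈ (ℝ ∪ {∞})^m`. -/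
def TInfty {n m : ℕ} (f : EuclideanSpace ℝ (Fin n) → EuclideanSpace ℝ (Fin m))
    (Ω : Set (EuclideanSpace ℝ (Fin n))) (ybar : Fin m → WithTop ℝ) :
    Set (EuclideanSpace ℝ (Fin m)) :=
  {y | ∃ x : ℕ → EuclideanSpace ℝ (Fin n), (∀ k, x k ∈ tangencySet f Ω) ∧
    (∀ k i, ((f (x k) i : ℝ) : WithTop ℝ) ≤ ybar i) ∧
    Tendsto (fun k => ‖x k‖) atTop atTop ∧ Tendsto (fun k => f (x k)) atTop (𝓝 y)}

/-- The Palais–Smale condition for `f|_Ω`: `K̃_∞(f,Ω) = ∅` (the case `ȳ = (∞,…,∞)`). -/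
def PalaisSmale {n m : ℕ} (f : EuclideanSpace ℝ (Fin n) → EuclideanSpace ℝ (Fin m))
    (Ω : Set (EuclideanSpace ℝ (Fin n))) : Prop :=
  KTildeInfty f Ω (fun _ => ⊤) = ∅

/-- The weak Palais–Smale condition for `f|_Ω`: `K_∞(f,Ω) = ∅`. -/
def WeakPalaisSmale {n m : ℕ} (f : EuclideanSpace ℝ (Fin n) → EuclideanSpace ℝ (Fin m))
    (Ω : Set (EuclideanSpace ℝ (Fin n))) : Prop :=
  KInfty f Ω (fun _ => ⊤) = ∅

/-- `f|_Ω` is M-tame: `T_∞(f,Ω) = ∅`. -/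
def MTame {n m : ℕ} (f : EuclideanSpace ℝ (Fin n) → EuclideanSpace ℝ (Fin m))
    (Ω : Set (EuclideanSpace ℝ (Fin n))) : Prop :=
  TInfty f Ω (fun _ => ⊤) = ∅

end

end VectorOpt

/-! All four conditions are equivalent to boundedness of the sublevel sets of `f` on `Ω`
(`HasBoundedSublevels`). Under the recession hypothesis, the part of `f '' Ω` below any level is
bounded: otherwise, normalising unbounded values gives a unit recession direction in the nonpositive
orthant. So properness amounts to bounded sublevels, and values bounded above have convergent
subsequences. Bounded sublevels exclude every sequence in the other conditions, since convergent
values lie eventually below one level.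

Conversely, suppose a sublevel is unbounded. The function `max fᵢ` is bounded below on `Ω`; it is
perturbed smoothly and minimised. A quadratic centred at a far, nearly optimal point makes `‖z‖
ν(z)` small (`exists_norm_mul_rabier_le`); the term `(‖x‖² - s)²`, whose gradient is radial, gives
far points of `Γ` (`exists_mem_tangencySet`). Both use the multiplier rule `exists_multipliers`:
smooth the maximum by log-sum-exp, give each `fᵢ` its own variable tied to the common one by a
quadratic penalty, and pass to the limit.

A properly efficient point is a minimiser of `max fᵢ + ρ ∑ fᵢ`, with `ρ > 0` supplied by the
recession hypothesis. -/

namespace VectorOpt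

/-! ### Gradients and first-order conditions -/

section Gradient

variable {E : Type*} [NormedAddCommGroup E] [InnerProductSpace ℝ E] [CompleteSpace E]

theorem hasGradientAt_add {f g : E → ℝ} {a b x : E} (hf : HasGradientAt f a x)
    (hg : HasGradientAt g b x) : HasGradientAt (fun y => f y + g y) (a + b) x := by
  rw [hasGradientAt_iff_hasFDerivAt] at *
  rw [map_add]
  exact hf.fun_add hg

theorem hasGradientAt_sum {ι : Type*} (s : Finset ι) {f : ι → E → ℝ} {a : ι → E} {x : E}
    (hf : ∀ i ∈ s, HasGradientAt (f i) (a i) x) :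
    HasGradientAt (fun y => ∑ i ∈ s, f i y) (∑ i ∈ s, a i) x := by
  simp only [hasGradientAt_iff_hasFDerivAt] at *
  rw [map_sum]
  exact HasFDerivAt.fun_sum hf

theorem hasGradientAt_const_mul_norm_sub_sq (c : ℝ) (a x : E) :
    HasGradientAt (fun y => c * ‖y - a‖ ^ 2) ((2 * c) • (x - a)) x := by
  rw [hasGradientAt_iff_hasFDerivAt]
  have h := ((hasFDerivAt_id x).sub_const a).norm_sq.const_mul c
  refine h.congr_fderiv ?_
  ext y
  simp
  ring

/-- First-order necessary condition for a local minimum over a set. -/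
theorem neg_gradient_mem_regularNormalCone {G : E → ℝ} {d u : E} {S : Set E}
    (hG : HasGradientAt G d u) (hmin : IsLocalMinOn G S u) :
    -d ∈ regularNormalCone S u := by
  intro ε hε
  have h1 := ((hasGradientAt_iff_isLittleO.1 hG).def hε).filter_mono (nhdsWithin_le_nhds (s := S))
  filter_upwards [h1, hmin] with y hy hy'
  rw [Real.norm_eq_abs, abs_le] at hy
  rw [inner_neg_left]
  linarith [hy.2]

end Gradient

/-! ### Fréchet subgradients and epigraph normals -/

section FrechetSubgradient

variable {E : Type*} [NormedAddCommGroup E] [InnerProductSpace ℝ E]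

/-- `v` is a regular (Fréchet) subgradient of `φ` at `x`. -/
def IsFrechetSubgradient (φ : E → ℝ) (x v : E) : Prop :=
  ∀ ε : ℝ, 0 < ε → ∀ᶠ u in 𝓝 x, inner ℝ v (u - x) ≤ φ u - φ x + ε * ‖u - x‖

theorem IsFrechetSubgradient.mem_regularNormalCone_epigraph {φ : E → ℝ} {x v : E}
    (h : IsFrechetSubgradient φ x v) :
    WithLp.toLp 2 (v, (-1 : ℝ)) ∈ regularNormalCone (epigraph φ) (WithLp.toLp 2 (x, φ x)) := by
  intro ε hε
  have hcont : Continuous fun p : WithLp 2 (E × ℝ) => p.fst :=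
    continuous_fst.comp (WithLp.prod_continuous_ofLp 2 E ℝ)
  have h1 : ∀ᶠ p : WithLp 2 (E × ℝ) in 𝓝 (WithLp.toLp 2 (x, φ x)),
      inner ℝ v (p.fst - x) ≤ φ p.fst - φ x + ε * ‖p.fst - x‖ :=
    (hcont.tendsto (WithLp.toLp 2 (x, φ x))).eventually (h ε hε)
  filter_upwards [h1.filter_mono nhdsWithin_le_nhds, self_mem_nhdsWithin] with p hp hpe
  have hle : ‖p.fst - x‖ ≤ ‖p - WithLp.toLp 2 (x, φ x)‖ := by
    apply le_of_sq_le_sq _ (norm_nonneg _)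
    rw [WithLp.prod_norm_sq_eq_of_L2 (p - _)]
    simp only [WithLp.sub_fst]
    exact le_add_of_nonneg_right (sq_nonneg _)
  have hpe' : φ p.fst ≤ p.snd := hpe
  have := mul_le_mul_of_nonneg_left hle hε.le
  rw [WithLp.prod_inner_apply]
  simp
  linarith

/-- Test the subgradient inequality along `x + t • v` as `t ↓ 0`. The bound later gives compactness
of the subgradients. -/
theorem IsFrechetSubgradient.norm_le {φ : E → ℝ} {x v : E} (h : IsFrechetSubgradient φ x v)
    {L : ℝ} (hL0 : 0 ≤ L) (hL : ∀ᶠ u in 𝓝 x, φ u - φ x ≤ L * ‖u - x‖) : ‖v‖ ≤ L := by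
  refine le_of_forall_pos_le_add fun ε hε => ?_
  rcases eq_or_ne v 0 with rfl | hv
  · rw [norm_zero]
    positivity
  have hv' : 0 < ‖v‖ := norm_pos_iff.2 hv
  have hlim : Tendsto (fun t : ℝ => x + t • v) (𝓝[>] 0) (𝓝 x) := by
    have : Tendsto (fun t : ℝ => x + t • v) (𝓝 0) (𝓝 (x + (0 : ℝ) • v)) :=
      (Continuous.tendsto (by fun_prop) 0)
    simpa using this.mono_left nhdsWithin_le_nhds
  obtain ⟨t, ht1, ht2⟩ := ((hlim.eventually ((h ε hε).and hL)).and self_mem_nhdsWithin).exists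
  have ht : 0 < t := ht2
  obtain ⟨h1, h2⟩ := ht1
  simp only [add_sub_cancel_left, inner_smul_right, real_inner_self_eq_norm_sq, norm_smul,
    Real.norm_eq_abs, abs_of_pos ht] at h1 h2
  have h3 : t * ‖v‖ * ‖v‖ ≤ t * ‖v‖ * (L + ε) := by nlinarith
  exact le_of_mul_le_mul_left h3 (by positivity)

/-- Expand `h ∘ φ + G` to first order and divide by `q > 0`. The Lipschitz bound turns an error `o(φ
y - φ x)` into `o(y - x)`. -/
theorem isFrechetSubgradient_of_isLocalMin [CompleteSpace E] {φ G : E → ℝ} {h : ℝ → ℝ} {q : ℝ}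
    {x v : E} (hφ : LocallyLipschitz φ) (hh : HasDerivAt h q (φ x)) (hq : 0 < q)
    (hG : HasGradientAt G (-(q • v)) x) (hmin : IsLocalMin (fun y => h (φ y) + G y) x) :
    IsFrechetSubgradient φ x v := by
  obtain ⟨K, t, ht, hK⟩ := hφ x
  have hO : (fun y => φ y - φ x) =O[𝓝 x] fun y => y - x := by
    refine Asymptotics.IsBigO.of_bound K ?_
    filter_upwards [ht] with y hy
    simpa [dist_eq_norm] using hK.dist_le_mul y hy x (mem_of_mem_nhds ht)
  have h1 : (fun y => h (φ y) - h (φ x) - (φ y - φ x) * q) =o[𝓝 x] fun y => y - x :=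
    (hh.isLittleO.comp_tendsto (hφ.continuous.tendsto x)).trans_isBigO hO
  have h2 := h1.add (hasGradientAt_iff_isLittleO.1 hG)
  intro ε hε
  filter_upwards [h2.def (mul_pos hε hq), hmin] with y hy hy'
  rw [Real.norm_eq_abs, abs_le] at hy
  have h3 := hy.2
  rw [inner_neg_left, inner_smul_left] at h3
  simp only [conj_trivial] at h3
  have h4 : q * inner ℝ v (y - x) ≤ q * (φ y - φ x + ε * ‖y - x‖) := by nlinarith
  exact le_of_mul_le_mul_left h4 hq

theorem mem_subdifferential_of_tendsto {φ : E → ℝ} (hφ : Continuous φ) {x v : E} {xs vs : ℕ → E}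
    (hxs : Tendsto xs atTop (𝓝 x)) (hvs : Tendsto vs atTop (𝓝 v))
    (h : ∀ k, IsFrechetSubgradient φ (xs k) (vs k)) : v ∈ subdifferential φ x := by
  have hc := WithLp.prod_continuous_toLp 2 E ℝ
  refine ⟨fun k => WithLp.toLp 2 (xs k, φ (xs k)), fun k => WithLp.toLp 2 (vs k, -1),
    fun k => le_refl (φ (xs k)), ?_, fun k => (h k).mem_regularNormalCone_epigraph, ?_⟩
  · exact (hc.tendsto _).comp (hxs.prodMk_nhds ((hφ.tendsto x).comp hxs))
  · exact (hc.tendsto _).comp (hvs.prodMk_nhds tendsto_const_nhds)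

end FrechetSubgradient

/-! ### Smoothing the maximum -/

section LogSumExp

variable {ι : Type*} [Fintype ι] [Nonempty ι]

/-- The smooth approximation `κ⁻¹ log ∑ exp (κ αᵢ)` of `max αᵢ`. -/
noncomputable def logSumExp (κ : ℝ) (α : ι → ℝ) : ℝ :=
  κ⁻¹ * Real.log (∑ i, Real.exp (κ * α i))

/-- The partial derivatives of `logSumExp`. -/
noncomputable def softmax (κ : ℝ) (α : ι → ℝ) (i : ι) : ℝ :=
  Real.exp (κ * α i) / ∑ j, Real.exp (κ * α j)

theorem sum_exp_pos (κ : ℝ) (α : ι → ℝ) : 0 < ∑ i, Real.exp (κ * α i) :=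
  Finset.sum_pos (fun _ _ => Real.exp_pos _) Finset.univ_nonempty

theorem softmax_pos (κ : ℝ) (α : ι → ℝ) (i : ι) : 0 < softmax κ α i :=
  div_pos (Real.exp_pos _) (sum_exp_pos κ α)

theorem sum_softmax (κ : ℝ) (α : ι → ℝ) : ∑ i, softmax κ α i = 1 := by
  unfold softmax
  rw [← Finset.sum_div, div_self (sum_exp_pos κ α).ne']

theorem continuous_logSumExp (κ : ℝ) : Continuous (logSumExp κ : (ι → ℝ) → ℝ) := by
  unfold logSumExp
  refine continuous_const.mul (Continuous.log (by fun_prop) fun α => (sum_exp_pos κ α).ne')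

theorem le_logSumExp {κ : ℝ} (hκ : 0 < κ) (α : ι → ℝ) (i : ι) : α i ≤ logSumExp κ α := by
  have h1 : Real.exp (κ * α i) ≤ ∑ j, Real.exp (κ * α j) :=
    Finset.single_le_sum (f := fun j => Real.exp (κ * α j))
      (fun j _ => (Real.exp_pos _).le) (Finset.mem_univ i)
  have h2 := (Real.le_log_iff_exp_le (sum_exp_pos κ α)).2 h1
  unfold logSumExp
  rw [← div_eq_inv_mul, le_div_iff₀ hκ]
  linarith

theorem logSumExp_le {κ : ℝ} (hκ : 0 < κ) {α : ι → ℝ} {M : ℝ} (h : ∀ i, α i ≤ M) :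
    logSumExp κ α ≤ M + κ⁻¹ * Real.log (Fintype.card ι) := by
  have hcard : (0 : ℝ) < Fintype.card ι := by exact_mod_cast Fintype.card_pos
  have h1 : ∑ j, Real.exp (κ * α j) ≤ Fintype.card ι * Real.exp (κ * M) := by
    have : ∀ j ∈ Finset.univ, Real.exp (κ * α j) ≤ Real.exp (κ * M) := fun j _ =>
      Real.exp_le_exp.2 (mul_le_mul_of_nonneg_left (h j) hκ.le)
    simpa using Finset.sum_le_card_nsmul _ _ _ this
  have h2 := Real.log_le_log (sum_exp_pos κ α) h1
  rw [Real.log_mul hcard.ne' (Real.exp_pos _).ne', Real.log_exp] at h2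
  unfold logSumExp
  calc _ ≤ κ⁻¹ * (Real.log (Fintype.card ι) + κ * M) :=
        mul_le_mul_of_nonneg_left h2 (inv_pos.2 hκ).le
    _ = _ := by field_simp; ring

/-- Each component gets its own variable, so single-coordinate derivatives suffice. -/
theorem hasDerivAt_logSumExp_update [DecidableEq ι] {κ : ℝ} (hκ : 0 < κ) (α : ι → ℝ) (i : ι) :
    HasDerivAt (fun s => logSumExp κ (Function.update α i s)) (softmax κ α i) (α i) := by
  unfold logSumExp
  have h1 : HasDerivAt (fun s => ∑ j, Real.exp (κ * Function.update α i s j))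
      (∑ j, if j = i then Real.exp (κ * α i) * κ else 0) (α i) := by
    refine HasDerivAt.fun_sum fun j _ => ?_
    by_cases hj : j = i
    · subst hj
      simpa using ((hasDerivAt_id (α j)).const_mul κ).exp
    · simpa [hj] using hasDerivAt_const (α i) (Real.exp (κ * α j))
  have h2 := (h1.log (by simpa using (sum_exp_pos κ α).ne')).const_mul κ⁻¹
  refine h2.congr_deriv ?_
  simp only [Function.update_eq_self, Finset.sum_ite_eq', Finset.mem_univ, if_true, softmax]
  field_simp

end LogSumExp

/-! ### Multiplier rule for `max fᵢ + g` -/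

section MultiplierRule

variable {E : Type*} [NormedAddCommGroup E] [InnerProductSpace ℝ E]
variable {ι : Type*} [Fintype ι] [Nonempty ι]

/-- The pointwise maximum of a finite family of functions. -/
noncomputable def maxFun {X : Type*} (f : ι → X → ℝ) (x : X) : ℝ :=
  Finset.univ.sup' Finset.univ_nonempty fun i => f i x

theorem le_maxFun {X : Type*} (f : ι → X → ℝ) (x : X) (i : ι) : f i x ≤ maxFun f x :=
  Finset.le_sup' (fun i => f i x) (Finset.mem_univ i)

theorem maxFun_le_iff {X : Type*} {f : ι → X → ℝ} {x : X} {a : ℝ} :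
    maxFun f x ≤ a ↔ ∀ i, f i x ≤ a := by
  simp [maxFun, Finset.sup'_le_iff]

theorem exists_eq_maxFun {X : Type*} (f : ι → X → ℝ) (x : X) : ∃ i, maxFun f x = f i x := by
  obtain ⟨i, -, hi⟩ := Finset.exists_mem_eq_sup' Finset.univ_nonempty fun i => f i x
  exact ⟨i, hi⟩

theorem continuous_maxFun {X : Type*} [TopologicalSpace X] {f : ι → X → ℝ}
    (hf : ∀ i, Continuous (f i)) : Continuous (maxFun f) := by
  unfold maxFun
  exact Continuous.finset_sup'_apply _ fun i _ => hf i

/-- The smooth decoupled penalisation of `max fᵢ + g` over `Ω` near `z`. -/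
noncomputable def penalized (f : ι → E → ℝ) (g : E → ℝ) (z : E) (κ : ℝ) (p : E × (ι → E)) : ℝ :=
  logSumExp κ (fun i => f i (p.2 i)) + g p.1 + 1 / 2 * ‖p.1 - z‖ ^ 2 +
    ∑ i, κ / 2 * ‖p.2 i - p.1‖ ^ 2

omit [InnerProductSpace ℝ E] in
theorem continuous_penalized {f : ι → E → ℝ} (hf : ∀ i, Continuous (f i)) {g : E → ℝ}
    (hg : Continuous g) (z : E) (κ : ℝ) : Continuous (penalized f g z κ) := by
  unfold penalized
  have h1 : Continuous fun p : E × (ι → E) => logSumExp κ (fun i => f i (p.2 i)) :=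
    (continuous_logSumExp κ).comp (continuous_pi fun i => (hf i).comp (by fun_prop))
  fun_prop

/-- First-order conditions at a minimiser of the penalised problem. -/
theorem penalized_stationary [CompleteSpace E] {f : ι → E → ℝ} (hf : ∀ i, LocallyLipschitz (f i))
    {Ω : Set E} {g : E → ℝ} {g' : E → E} (hg : ∀ x, HasGradientAt g (g' x) x) {z : E} {r κ : ℝ}
    (hκ : 0 < κ) {u : E} {x : ι → E} (hu : u ∈ Ω ∩ Metric.ball z r)
    (hx : ∀ i, x i ∈ Metric.ball z r)
    (hmin : IsMinOn (penalized f g z κ)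
      ((Ω ∩ Metric.closedBall z r) ×ˢ Set.univ.pi fun _ => Metric.closedBall z r) (u, x)) :
    ∃ (c : ι → ℝ) (v : ι → E), (∀ i, 0 ≤ c i) ∧ ∑ i, c i = 1 ∧
      (∀ i, IsFrechetSubgradient (f i) (x i) (v i)) ∧
      -(g' u + (u - z) + ∑ i, c i • v i) ∈ regularNormalCone Ω u := by
  classical
  have hx' : ∀ i, x i ∈ Metric.closedBall z r := fun i => Metric.ball_subset_closedBall (hx i)
  set c : ι → ℝ := softmax κ fun i => f i (x i) with hc
  have hcpos : ∀ i, 0 < c i := fun i => softmax_pos _ _ i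
  -- Stationarity in the `i`-th copy reads `c i • v i = κ • (u - x i)`, which is exactly the
  -- penalty's contribution to the condition in `u`.
  refine ⟨c, fun i => (κ / c i) • (u - x i), fun i => (hcpos i).le, sum_softmax _ _,
    fun i => ?_, ?_⟩
  · refine isFrechetSubgradient_of_isLocalMin (hf i)
      (hasDerivAt_logSumExp_update hκ (fun i => f i (x i)) i) (softmax_pos _ _ _)
      (G := fun y => κ / 2 * ‖y - u‖ ^ 2) ?_ ?_
    · convert hasGradientAt_const_mul_norm_sub_sq (κ / 2) u (x i) using 1
      rw [smul_smul, mul_div_cancel₀ _ (hcpos i).ne', ← smul_neg, neg_sub]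
      congr 1
      ring
    · filter_upwards [Metric.isOpen_ball.mem_nhds (hx i)] with y hy
      have hmem : (u, Function.update x i y) ∈
          (Ω ∩ Metric.closedBall z r) ×ˢ Set.univ.pi fun _ : ι => Metric.closedBall z r := by
        refine ⟨⟨hu.1, Metric.ball_subset_closedBall hu.2⟩, fun j _ => ?_⟩
        by_cases hj : j = i
        · subst hj
          simpa using Metric.ball_subset_closedBall hy
        · simpa [hj] using hx' j
      have h := hmin hmem
      have hsum : ∀ w : E, ∑ j, κ / 2 * ‖Function.update x i w j - u‖ ^ 2 =
          κ / 2 * ‖w - u‖ ^ 2 + ∑ j ∈ Finset.univ.erase i, κ / 2 * ‖x j - u‖ ^ 2 := by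
        intro w
        rw [← Finset.add_sum_erase _ _ (Finset.mem_univ i), Function.update_self]
        congr 1
        refine Finset.sum_congr rfl fun j hj => ?_
        rw [Function.update_of_ne (Finset.ne_of_mem_erase hj)]
      have hfun : ∀ w : E, (fun j => f j (Function.update x i w j)) =
          Function.update (fun j => f j (x j)) i (f i w) := by
        intro w
        ext j
        by_cases hj : j = i
        · subst hj
          simp
        · simp [hj]
      have hself := hsum (x i)
      rw [Function.update_eq_self] at hself
      simp only [Set.mem_ofPred_eq, penalized, hsum, hfun, hself] at h
      simp only [Function.update_eq_self]
      linarith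
  · have hG : HasGradientAt (fun y => g y + 1 / 2 * ‖y - z‖ ^ 2 + ∑ i, κ / 2 * ‖y - x i‖ ^ 2)
        (g' u + (2 * (1 / 2) : ℝ) • (u - z) + ∑ i, (2 * (κ / 2)) • (u - x i)) u :=
      hasGradientAt_add (hasGradientAt_add (hg u) (hasGradientAt_const_mul_norm_sub_sq _ _ _))
        (hasGradientAt_sum _ fun i _ => hasGradientAt_const_mul_norm_sub_sq _ _ _)
    have hG' : g' u + (u - z) + ∑ i, c i • (κ / c i) • (u - x i) =
        g' u + (2 * (1 / 2) : ℝ) • (u - z) + ∑ i, (2 * (κ / 2)) • (u - x i) := by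
      congr 1
      · norm_num
      · refine Finset.sum_congr rfl fun i _ => ?_
        rw [smul_smul, mul_div_cancel₀ _ (hcpos i).ne']
        congr 1
        ring
    rw [hG']
    refine neg_gradient_mem_regularNormalCone hG ?_
    filter_upwards [self_mem_nhdsWithin,
      nhdsWithin_le_nhds (Metric.isOpen_ball.mem_nhds hu.2)] with y hyΩ hy
    have hmem : (y, x) ∈
        (Ω ∩ Metric.closedBall z r) ×ˢ Set.univ.pi fun _ : ι => Metric.closedBall z r :=
      ⟨⟨hyΩ, Metric.ball_subset_closedBall hy⟩, fun j _ => hx' j⟩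
    have h := hmin hmem
    simp only [Set.mem_ofPred_eq, penalized] at h
    simp only [norm_sub_rev y (x _), norm_sub_rev u (x _)]
    linarith

/-- Fuzzy multiplier rule at a local minimiser of `max fᵢ + g` over `Ω`. -/
theorem exists_fuzzy_multipliers [ProperSpace E] {f : ι → E → ℝ}
    (hf : ∀ i, LocallyLipschitz (f i)) {Ω : Set E} (hcl : IsClosed Ω) {g : E → ℝ} {g' : E → E}
    (hg : ∀ x, HasGradientAt g (g' x) x) {z : E} (hz : z ∈ Ω) {r : ℝ} (hr : 0 < r)
    (hmin : ∀ x ∈ Ω, x ∈ Metric.closedBall z r → maxFun f z + g z ≤ maxFun f x + g x)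
    {δ : ℝ} (hδ : 0 < δ) :
    ∃ (u : E) (x : ι → E) (c : ι → ℝ) (v : ι → E), u ∈ Ω ∧ dist u z < δ ∧
      (∀ i, dist (x i) z < δ) ∧ (∀ i, 0 ≤ c i) ∧ ∑ i, c i = 1 ∧
      (∀ i, IsFrechetSubgradient (f i) (x i) (v i)) ∧
      -(g' u + (u - z) + ∑ i, c i • v i) ∈ regularNormalCone Ω u := by
  have hfc : ∀ i, Continuous (f i) := fun i => (hf i).continuous
  have hgc : Continuous g := continuous_iff_continuousAt.2 fun x => (hg x).continuousAt
  set K : Set (E × (ι → E)) :=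
    (Ω ∩ Metric.closedBall z r) ×ˢ Set.univ.pi fun _ => Metric.closedBall z r with hKdef
  have hK : IsCompact K := ((isCompact_closedBall z r).inter_left hcl).prod
    (isCompact_univ_pi fun _ => isCompact_closedBall z r)
  have hzK : (z, fun _ => z) ∈ K :=
    ⟨⟨hz, Metric.mem_closedBall_self hr.le⟩, fun _ _ => Metric.mem_closedBall_self hr.le⟩
  have hex : ∀ k : ℕ, ∃ p ∈ K, IsMinOn (penalized f g z (k + 1)) K p := fun k =>
    hK.exists_isMinOn ⟨_, hzK⟩ (continuous_penalized hfc hgc z _).continuousOn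
  choose p hpK hpmin using hex
  obtain ⟨⟨ub, xb⟩, hbK, φ, hφ, hlim⟩ := hK.tendsto_subseq hpK
  have hlu : Tendsto (fun k => (p (φ k)).1) atTop (𝓝 ub) := (continuous_fst.tendsto _).comp hlim
  have hlx : ∀ i, Tendsto (fun k => (p (φ k)).2 i) atTop (𝓝 (xb i)) := fun i =>
    (((continuous_apply i).comp continuous_snd).tendsto _).comp hlim
  have hinv : Tendsto (fun k => ((φ k : ℝ) + 1)⁻¹) atTop (𝓝 0) :=
    tendsto_inv_atTop_zero.comp (tendsto_atTop_add_const_right _ _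
      (tendsto_natCast_atTop_atTop.comp hφ.tendsto_atTop))
  -- Compare with the diagonal point `(z, …, z)`, where the penalty vanishes, keeping one component
  -- and one penalty term.
  have hbound : ∀ k i j, f i ((p (φ k)).2 i) + g (p (φ k)).1 + 1 / 2 * ‖(p (φ k)).1 - z‖ ^ 2 +
      ((φ k : ℝ) + 1) / 2 * ‖(p (φ k)).2 j - (p (φ k)).1‖ ^ 2 ≤
      maxFun f z + ((φ k : ℝ) + 1)⁻¹ * Real.log (Fintype.card ι) + g z := by
    intro k i j
    have hκ : (0 : ℝ) < φ k + 1 := by positivity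
    have h1 := hpmin (φ k) hzK
    have h2 := logSumExp_le hκ (α := fun i => f i z) (le_maxFun f z)
    have h3 := le_logSumExp hκ (fun i => f i ((p (φ k)).2 i)) i
    have h4 : ((φ k : ℝ) + 1) / 2 * ‖(p (φ k)).2 j - (p (φ k)).1‖ ^ 2 ≤
        ∑ j, ((φ k : ℝ) + 1) / 2 * ‖(p (φ k)).2 j - (p (φ k)).1‖ ^ 2 :=
      Finset.single_le_sum
        (f := fun j => ((φ k : ℝ) + 1) / 2 * ‖(p (φ k)).2 j - (p (φ k)).1‖ ^ 2)
        (fun j _ => by positivity) (Finset.mem_univ j)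
    simp only [Set.mem_ofPred_eq, penalized, sub_self, norm_zero] at h1
    norm_num at h1
    linarith
  -- The penalty stays bounded while its coefficient tends to infinity, so the copies merge.
  have hxu : ∀ j, xb j = ub := by
    intro j
    have i := Classical.arbitrary ι
    have h1 : Tendsto (fun k => ‖(p (φ k)).2 j - (p (φ k)).1‖ ^ 2) atTop
        (𝓝 (‖xb j - ub‖ ^ 2)) := (((hlx j).sub hlu).norm).pow 2
    have h2 : Tendsto (fun k => 2 * ((φ k : ℝ) + 1)⁻¹ * (maxFun f z +
        ((φ k : ℝ) + 1)⁻¹ * Real.log (Fintype.card ι) + g z - f i ((p (φ k)).2 i) -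
          g (p (φ k)).1)) atTop (𝓝 (2 * 0 * (maxFun f z +
        0 * Real.log (Fintype.card ι) + g z - f i (xb i) - g ub))) :=
      (hinv.const_mul 2).mul ((((((hinv.mul_const _).const_add _).add_const _).sub
        (((hfc i).tendsto _).comp (hlx i))).sub ((hgc.tendsto _).comp hlu)))
    have h3 : ‖xb j - ub‖ ^ 2 ≤ 0 := by
      have := le_of_tendsto_of_tendsto' h1 h2 fun k => ?_
      · simpa using this
      · have hκ : (0 : ℝ) < φ k + 1 := by positivity
        have h := hbound k i j
        have h0 : 0 ≤ 1 / 2 * ‖(p (φ k)).1 - z‖ ^ 2 := by positivity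
        rw [mul_assoc, ← div_eq_inv_mul, ← mul_div_assoc, le_div_iff₀ hκ]
        linarith
    have h4 : ‖xb j - ub‖ = 0 := by nlinarith [norm_nonneg (xb j - ub)]
    exact sub_eq_zero.1 (norm_eq_zero.1 h4)
  -- In the limit the proximal term `1 / 2 * ‖ub - z‖ ^ 2` is squeezed to zero by minimality of `z`.
  have huz : ub = z := by
    have h1 : ∀ i, f i ub + g ub + 1 / 2 * ‖ub - z‖ ^ 2 ≤ maxFun f z + g z := by
      intro i
      have h2 : Tendsto (fun k => f i ((p (φ k)).2 i) + g (p (φ k)).1 +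
          1 / 2 * ‖(p (φ k)).1 - z‖ ^ 2) atTop
          (𝓝 (f i (xb i) + g ub + 1 / 2 * ‖ub - z‖ ^ 2)) :=
        ((((hfc i).tendsto _).comp (hlx i)).add ((hgc.tendsto _).comp hlu)).add
          ((((hlu.sub_const z).norm).pow 2).const_mul _)
      have h3 : Tendsto (fun k => maxFun f z +
          ((φ k : ℝ) + 1)⁻¹ * Real.log (Fintype.card ι) + g z) atTop
          (𝓝 (maxFun f z + 0 * Real.log (Fintype.card ι) + g z)) :=
        ((hinv.mul_const _).const_add _).add_const _
      have h4 := le_of_tendsto_of_tendsto' h2 h3 fun k => by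
        have h := hbound k i i
        have h0 : 0 ≤ ((φ k : ℝ) + 1) / 2 * ‖(p (φ k)).2 i - (p (φ k)).1‖ ^ 2 := by positivity
        linarith
      rw [hxu i] at h4
      linarith
    obtain ⟨i, hi⟩ := exists_eq_maxFun f ub
    have h2 := h1 i
    have h3 := hmin ub hbK.1.1 hbK.1.2
    have h4 : ‖ub - z‖ = 0 := by nlinarith [norm_nonneg (ub - z)]
    exact sub_eq_zero.1 (norm_eq_zero.1 h4)
  subst huz
  -- Staying within `r` makes the closed-ball constraints inactive.
  have hmin' : 0 < min δ r := lt_min hδ hr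
  have hev1 : ∀ᶠ k in atTop, dist (p (φ k)).1 ub < min δ r := Metric.tendsto_nhds.1 hlu _ hmin'
  have hev2 : ∀ᶠ k in atTop, ∀ i, dist ((p (φ k)).2 i) ub < min δ r := by
    rw [eventually_all]
    intro i
    have := hlx i
    rw [hxu i] at this
    exact Metric.tendsto_nhds.1 this _ hmin'
  obtain ⟨k, hk1, hk2⟩ := (hev1.and hev2).exists
  obtain ⟨c, v, h1, h2, h3, h4⟩ := penalized_stationary hf hg (r := r) (κ := (φ k : ℝ) + 1)
    (by positivity) (u := (p (φ k)).1) (x := (p (φ k)).2)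
    ⟨(hpK (φ k)).1.1, hk1.trans_le (min_le_right _ _)⟩
    (fun i => (hk2 i).trans_le (min_le_right _ _)) (hpmin (φ k))
  exact ⟨_, _, c, v, (hpK (φ k)).1.1, hk1.trans_le (min_le_left _ _),
    fun i => (hk2 i).trans_le (min_le_left _ _), h1, h2, h3, h4⟩

/-- Multiplier rule at a local minimiser of `max fᵢ + g` over `Ω`, in terms of limiting
subdifferentials and normals. -/
theorem exists_multipliers [ProperSpace E] {f : ι → E → ℝ}
    (hf : ∀ i, LocallyLipschitz (f i)) {Ω : Set E} (hcl : IsClosed Ω) {g : E → ℝ} {g' : E → E}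
    (hg : ∀ x, HasGradientAt g (g' x) x) (hg' : Continuous g') {z : E} (hz : z ∈ Ω) {r : ℝ}
    (hr : 0 < r)
    (hmin : ∀ x ∈ Ω, x ∈ Metric.closedBall z r → maxFun f z + g z ≤ maxFun f x + g x) :
    ∃ (c : ι → ℝ) (v : ι → E) (w : E), (∀ i, v i ∈ subdifferential (f i) z) ∧
      w ∈ limitingNormalCone Ω z ∧ (∀ i, 0 ≤ c i) ∧ ∑ i, c i = 1 ∧
      (∑ i, c i • v i) + g' z + w = 0 := by
  have hLip : ∀ i, ∃ L δ : ℝ, 0 ≤ L ∧ 0 < δ ∧ ∀ x, dist x z < δ → ∀ v,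
      IsFrechetSubgradient (f i) x v → ‖v‖ ≤ L := by
    intro i
    obtain ⟨K, t, ht, hK⟩ := hf i z
    obtain ⟨δ, hδ, hball⟩ := Metric.mem_nhds_iff.1 ht
    refine ⟨K, δ, K.2, hδ, fun x hx v hv => hv.norm_le K.2 ?_⟩
    filter_upwards [Metric.isOpen_ball.mem_nhds (show x ∈ Metric.ball z δ from hx)] with y hy
    have h := hK.dist_le_mul y (hball hy) x (hball hx)
    rw [Real.dist_eq, dist_eq_norm] at h
    exact (le_abs_self _).trans h
  choose L δ hL hδ hbd using hLip
  have hinv : Tendsto (fun k : ℕ => 1 / ((k : ℝ) + 1)) atTop (𝓝 0) :=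
    tendsto_one_div_add_atTop_nhds_zero_nat
  set δ₀ : ℝ := Finset.univ.inf' Finset.univ_nonempty δ with hδ₀
  have hδ₀pos : 0 < δ₀ := (Finset.lt_inf'_iff _).2 fun i _ => hδ i
  -- `δ₀` keeps the points where the bounds `L` apply; the other term forces convergence to `z`.
  have hfuzzy := fun k : ℕ => exists_fuzzy_multipliers hf hcl hg hz hr hmin
    (δ := min δ₀ (1 / ((k : ℝ) + 1))) (lt_min hδ₀pos (by positivity))
  choose u x c v huΩ hu hx hc hcsum hv hw using hfuzzy
  have hlu : Tendsto u atTop (𝓝 z) := tendsto_iff_dist_tendsto_zero.2 <|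
    squeeze_zero (fun _ => dist_nonneg) (fun k => (hu k).le.trans (min_le_right _ _)) hinv
  have hlx : ∀ i, Tendsto (fun k => x k i) atTop (𝓝 z) := fun i =>
    tendsto_iff_dist_tendsto_zero.2 <|
      squeeze_zero (fun _ => dist_nonneg) (fun k => (hx k i).le.trans (min_le_right _ _)) hinv
  have hmem : ∀ k, (c k, v k) ∈ (Set.univ.pi fun _ : ι => Set.Icc (0 : ℝ) 1) ×ˢ
      (Set.univ.pi fun i : ι => Metric.closedBall (0 : E) (L i)) := by
    refine fun k => ⟨fun i _ => ⟨hc k i, ?_⟩, fun i _ => ?_⟩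
    · rw [← hcsum k]
      exact Finset.single_le_sum (fun j _ => hc k j) (Finset.mem_univ i)
    · rw [mem_closedBall_zero_iff]
      exact hbd i _ ((hx k i).trans_le ((min_le_left _ _).trans
        (Finset.inf'_le _ (Finset.mem_univ i)))) _ (hv k i)
  obtain ⟨⟨cb, vb⟩, hb, φ, hφ, hlim⟩ := ((isCompact_univ_pi fun _ => isCompact_Icc).prod
    (isCompact_univ_pi fun i => isCompact_closedBall (0 : E) (L i))).tendsto_subseq hmem
  have hlc : ∀ i, Tendsto (fun k => c (φ k) i) atTop (𝓝 (cb i)) := fun i =>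
    (((continuous_apply i).comp continuous_fst).tendsto _).comp hlim
  have hlv : ∀ i, Tendsto (fun k => v (φ k) i) atTop (𝓝 (vb i)) := fun i =>
    (((continuous_apply i).comp continuous_snd).tendsto _).comp hlim
  have hlu' := hlu.comp hφ.tendsto_atTop
  -- The normal is the limit of the fuzzy normals; `z - z` is the limit of the proximal gradient.
  refine ⟨cb, vb, -(g' z + (z - z) + ∑ i, cb i • vb i), fun i => ?_, ?_, fun i => (hb.1 i trivial).1,
    ?_, ?_⟩
  · exact mem_subdifferential_of_tendsto (hf i).continuous ((hlx i).comp hφ.tendsto_atTop) (hlv i)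
      fun k => hv (φ k) i
  · refine ⟨u ∘ φ, _, fun k => huΩ _, hlu', fun k => hw (φ k), ?_⟩
    exact ((((hg'.tendsto z).comp hlu').add (hlu'.sub_const z)).add
      (tendsto_finsetSum _ fun i _ => (hlc i).smul (hlv i))).neg
  · refine tendsto_nhds_unique (tendsto_finsetSum _ fun i _ => hlc i) ?_
    simp only [hcsum]
    exact tendsto_const_nhds
  · rw [sub_self]
    abel

end MultiplierRule

/-! ### Consequences of the recession condition -/

section Recession

variable {m : ℕ}

/-- If the recession cone of `Y` meets the nonpositive orthant only at `0`, then the same holds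
uniformly for a slightly larger cone, and the corresponding sublevel sets of `Y` are bounded. -/
theorem exists_bounded_augmented_sublevels {Y : Set (EuclideanSpace ℝ (Fin m))}
    (hrec : recessionCone Y ∩ -nonnegOrthant m = {0}) :
    ∃ ρ : ℝ, 0 < ρ ∧ ∀ a : ℝ, ∃ R : ℝ, ∀ y ∈ Y,
      (∀ i, y i + ρ * ∑ j, y j ≤ a) → ‖y‖ ≤ R := by
  by_contra! hcon
  -- This bound makes both `‖y k‖⁻¹` and `‖y k‖⁻¹ * a k` at most `1 / (k + 1)`.
  have h1 : ∀ k : ℕ, ∃ a : ℝ, ∃ y ∈ Y, (∀ i, y i + 1 / ((k : ℝ) + 1) * ∑ j, y j ≤ a) ∧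
      ((k : ℝ) + 1) * (1 + |a|) < ‖y‖ := by
    intro k
    obtain ⟨a, ha⟩ := hcon (1 / ((k : ℝ) + 1)) (by positivity)
    obtain ⟨y, hy, h⟩ := ha (((k : ℝ) + 1) * (1 + |a|))
    exact ⟨a, y, hy, h⟩
  choose a y hyY hya hyR using h1
  have hinv : Tendsto (fun k : ℕ => 1 / ((k : ℝ) + 1)) atTop (𝓝 0) :=
    tendsto_one_div_add_atTop_nhds_zero_nat
  have hpos : ∀ k, 0 < ‖y k‖ := fun k => lt_of_le_of_lt (by positivity) (hyR k)
  have ht : ∀ k, ‖y k‖⁻¹ ≤ 1 / ((k : ℝ) + 1) := fun k => by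
    rw [← one_div]
    refine one_div_le_one_div_of_le (by positivity) ((le_trans ?_ (hyR k).le))
    nlinarith [abs_nonneg (a k), mul_nonneg (show (0 : ℝ) ≤ k + 1 by positivity) (abs_nonneg (a k))]
  have hta : ∀ k, ‖y k‖⁻¹ * a k ≤ 1 / ((k : ℝ) + 1) := fun k => by
    rw [← div_eq_inv_mul, div_le_div_iff₀ (hpos k) (by positivity)]
    have h2 := hyR k
    have h3 := mul_le_mul_of_nonneg_left (le_abs_self (a k)) (show (0 : ℝ) ≤ k + 1 by positivity)
    nlinarith [show (0 : ℝ) < k + 1 by positivity]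
  have hunit : ∀ k, ‖y k‖⁻¹ • y k ∈ Metric.sphere (0 : EuclideanSpace ℝ (Fin m)) 1 := fun k => by
    rw [mem_sphere_zero_iff_norm, norm_smul, norm_inv, norm_norm, inv_mul_cancel₀ (hpos k).ne']
  obtain ⟨d, hd, φ, hφ, hlim⟩ := (isCompact_sphere _ _).tendsto_subseq hunit
  have htlim : Tendsto (fun k => ‖y k‖⁻¹) atTop (𝓝 0) :=
    squeeze_zero (fun k => (inv_pos.2 (hpos k)).le) ht hinv
  have hcoord : ∀ i, Tendsto (fun k => ‖y (φ k)‖⁻¹ * y (φ k) i) atTop (𝓝 (d i)) := fun i =>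
    ((EuclideanSpace.proj i : EuclideanSpace ℝ (Fin m) →L[ℝ] ℝ).continuous.tendsto d).comp hlim
  have hinv' := hinv.comp hφ.tendsto_atTop
  have hdneg : ∀ i, d i ≤ 0 := by
    intro i
    -- After division by the norm, the sum converges and its coefficient vanishes, leaving only `d
    -- i`.
    have h2 := (hcoord i).add (hinv'.mul (tendsto_finsetSum Finset.univ fun j _ => hcoord j))
    rw [zero_mul, add_zero] at h2
    refine le_of_tendsto_of_tendsto' h2 hinv' fun k => le_trans ?_ (hta (φ k))
    have h3 := mul_le_mul_of_nonneg_left (hya (φ k) i) (inv_pos.2 (hpos (φ k))).le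
    refine le_trans (le_of_eq ?_) h3
    simp only [Function.comp_apply]
    rw [← Finset.mul_sum]
    ring
  have hd0 : d ∈ ({0} : Set (EuclideanSpace ℝ (Fin m))) := by
    rw [← hrec]
    refine ⟨⟨fun k => ‖y (φ k)‖⁻¹, fun k => y (φ k), fun k => (inv_pos.2 (hpos _)).le,
      fun k => hyY _, htlim.comp hφ.tendsto_atTop, hlim⟩, ?_⟩
    intro i
    simpa using hdneg i
  rw [Set.mem_singleton_iff] at hd0
  rw [hd0] at hd
  simp at hd

theorem exists_bounded_sublevels {Y : Set (EuclideanSpace ℝ (Fin m))}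
    (hrec : recessionCone Y ∩ -nonnegOrthant m = {0}) (C : ℝ) :
    ∃ R : ℝ, ∀ y ∈ Y, (∀ i, y i ≤ C) → ‖y‖ ≤ R := by
  obtain ⟨ρ, hρ, h⟩ := exists_bounded_augmented_sublevels hrec
  obtain ⟨R, hR⟩ := h (C + ρ * ∑ _j : Fin m, C)
  refine ⟨R, fun y hy hyC => hR y hy fun i => add_le_add (hyC i) ?_⟩
  exact mul_le_mul_of_nonneg_left (Finset.sum_le_sum fun j _ => hyC j) hρ.le

end Recession

/-! ### Bounded sublevels and the four conditions -/

section Properness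

variable {n m : ℕ} {f : EuclideanSpace ℝ (Fin n) → EuclideanSpace ℝ (Fin m)}
  {Ω : Set (EuclideanSpace ℝ (Fin n))}

/-- Every sublevel set of `f|_Ω` is bounded. -/
def HasBoundedSublevels (f : EuclideanSpace ℝ (Fin n) → EuclideanSpace ℝ (Fin m))
    (Ω : Set (EuclideanSpace ℝ (Fin n))) : Prop :=
  ∀ C : ℝ, ∃ R : ℝ, ∀ x ∈ Ω, (∀ i, f x i ≤ C) → ‖x‖ ≤ R

theorem HasBoundedSublevels.false_of_seq (h : HasBoundedSublevels f Ω)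
    {x : ℕ → EuclideanSpace ℝ (Fin n)} (hx : ∀ k, x k ∈ Ω)
    (hn : Tendsto (fun k => ‖x k‖) atTop atTop) {C : ℝ} (hC : ∀ᶠ k in atTop, ∀ i, f (x k) i ≤ C) :
    False := by
  obtain ⟨R, hR⟩ := h C
  obtain ⟨k, h1, h2⟩ := (hC.and (hn.eventually_gt_atTop R)).exists
  exact absurd (hR _ (hx k) h1) (not_le.2 h2)

theorem HasBoundedSublevels.false_of_tendsto (h : HasBoundedSublevels f Ω)
    {x : ℕ → EuclideanSpace ℝ (Fin n)} (hx : ∀ k, x k ∈ Ω)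
    (hn : Tendsto (fun k => ‖x k‖) atTop atTop) {y : EuclideanSpace ℝ (Fin m)}
    (hy : Tendsto (fun k => f (x k)) atTop (𝓝 y)) : False := by
  refine h.false_of_seq hx hn (C := ‖y‖ + 1) ?_
  filter_upwards [hy.norm.eventually_lt_const (lt_add_one ‖y‖)] with k hk i
  exact (le_abs_self _).trans ((PiLp.norm_apply_le (f (x k)) i).trans hk.le)

theorem isProperOn_of_hasBoundedSublevels (h : HasBoundedSublevels f Ω) : IsProperOn f Ω := by
  intro y x hx hn hy
  refine (h.false_of_seq hx hn (C := ‖y‖) (Eventually.of_forall fun k i => ?_)).elim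
  exact (hy k i).trans ((le_abs_self _).trans (PiLp.norm_apply_le y i))

/-- On an unbounded sublevel, properness would force the values to infinity, while the recession
condition bounds them. -/
theorem hasBoundedSublevels_of_isProperOn
    (hrec : recessionCone (f '' Ω) ∩ -nonnegOrthant m = {0}) (h : IsProperOn f Ω) :
    HasBoundedSublevels f Ω := by
  intro C
  by_contra! hcon
  choose x hxΩ hxC hxn using fun k : ℕ => hcon k
  obtain ⟨R, hR⟩ := exists_bounded_sublevels hrec C
  have hn : Tendsto (fun k => ‖x k‖) atTop atTop :=
    tendsto_atTop_mono (fun k => (hxn k).le) tendsto_natCast_atTop_atTop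
  have h1 := h (WithLp.toLp 2 fun _ => C) x hxΩ hn hxC
  obtain ⟨k, hk⟩ := (h1.eventually_gt_atTop R).exists
  exact absurd (hR _ ⟨x k, hxΩ k, rfl⟩ (hxC k)) (not_le.2 hk)

theorem palaisSmale_of_hasBoundedSublevels (h : HasBoundedSublevels f Ω) : PalaisSmale f Ω :=
  Set.eq_empty_of_forall_notMem fun _ ⟨_, hx, _, hn, hy, _⟩ => h.false_of_tendsto hx hn hy

theorem mTame_of_hasBoundedSublevels (h : HasBoundedSublevels f Ω) : MTame f Ω :=
  Set.eq_empty_of_forall_notMem fun _ ⟨_, hx, _, hn, hy⟩ =>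
    h.false_of_tendsto (fun k => (hx k).1) hn hy

theorem weakPalaisSmale_of_palaisSmale (h : PalaisSmale f Ω) : WeakPalaisSmale f Ω := by
  refine Set.eq_empty_of_forall_notMem fun y ⟨x, hx, hle, hn, hy, hν⟩ => ?_
  refine Set.notMem_empty y (h ▸ ⟨x, hx, hle, hn, hy, ?_⟩)
  refine tendsto_of_tendsto_of_tendsto_of_le_of_le' tendsto_const_nhds hν
    (Eventually.of_forall fun _ => zero_le) ?_
  filter_upwards [hn.eventually_ge_atTop 1] with k hk
  refine le_mul_of_one_le_left zero_le ?_
  rw [← ofReal_norm]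
  simpa using ENNReal.ofReal_le_ofReal hk

/-- Points of `Ω` going to infinity with bounded values have a subsequence along which the values
converge. -/
theorem exists_subseq_tendsto_values
    (hrec : recessionCone (f '' Ω) ∩ -nonnegOrthant m = {0})
    {x : ℕ → EuclideanSpace ℝ (Fin n)} (hx : ∀ k, x k ∈ Ω) {C : ℝ} (hC : ∀ k i, f (x k) i ≤ C) :
    ∃ (y : EuclideanSpace ℝ (Fin m)) (φ : ℕ → ℕ), StrictMono φ ∧
      Tendsto (fun k => f (x (φ k))) atTop (𝓝 y) := by
  obtain ⟨R, hR⟩ := exists_bounded_sublevels hrec C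
  obtain ⟨y, -, φ, hφ, hlim⟩ := (isCompact_closedBall (0 : EuclideanSpace ℝ (Fin m)) R).tendsto_subseq
    (x := fun k => f (x k)) fun k =>
      mem_closedBall_zero_iff.2 (hR _ ⟨x k, hx k, rfl⟩ (hC k))
  exact ⟨y, φ, hφ, hlim⟩

theorem locallyLipschitz_coord (hf : LocallyLipschitz f) (i : Fin m) :
    LocallyLipschitz fun x => f x i :=
  (EuclideanSpace.proj i : EuclideanSpace ℝ (Fin m) →L[ℝ] ℝ).lipschitz.locallyLipschitz.comp hf

variable [Nonempty (Fin m)]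

/-- The maximum of the components of `f`. -/
noncomputable abbrev maxCoord (f : EuclideanSpace ℝ (Fin n) → EuclideanSpace ℝ (Fin m)) :
    EuclideanSpace ℝ (Fin n) → ℝ :=
  maxFun fun i x => f x i

/-- Where the maximum is nonpositive, the value lies in a bounded sublevel of `f '' Ω`. -/
theorem exists_lower_bound_maxCoord (hrec : recessionCone (f '' Ω) ∩ -nonnegOrthant m = {0}) :
    ∃ b : ℝ, ∀ x ∈ Ω, b ≤ maxCoord f x := by
  obtain ⟨R, hR⟩ := exists_bounded_sublevels hrec 0
  refine ⟨min 0 (-R), fun x hx => ?_⟩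
  by_cases h : maxCoord f x ≤ 0
  · have h1 := hR _ ⟨x, hx, rfl⟩ (maxFun_le_iff.1 h)
    have i := Classical.arbitrary (Fin m)
    have h2 := (abs_le.1 ((PiLp.norm_apply_le (f x) i).trans h1)).1
    exact (min_le_right _ _).trans (h2.trans (le_maxFun (fun i x => f x i) x i))
  · exact (min_le_left _ _).trans (not_le.1 h).le

theorem exists_multipliers_maxCoord (hf : LocallyLipschitz f) (hcl : IsClosed Ω)
    {g : EuclideanSpace ℝ (Fin n) → ℝ} {g' : EuclideanSpace ℝ (Fin n) → EuclideanSpace ℝ (Fin n)}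
    (hg : ∀ x, HasGradientAt g (g' x) x) (hg' : Continuous g') {z : EuclideanSpace ℝ (Fin n)}
    (hz : z ∈ Ω) {r : ℝ} (hr : 0 < r)
    (hmin : ∀ x ∈ Ω, x ∈ Metric.closedBall z r → maxCoord f z + g z ≤ maxCoord f x + g x) :
    ∃ (c : Fin m → ℝ) (v : Fin m → EuclideanSpace ℝ (Fin n)) (w : EuclideanSpace ℝ (Fin n)),
      (∀ i, v i ∈ symSubdifferential f i z) ∧ w ∈ limitingNormalCone Ω z ∧ (∀ i, 0 ≤ c i) ∧
      ∑ i, c i = 1 ∧ (∑ i, c i • v i) + g' z + w = 0 := by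
  obtain ⟨c, v, w, hv, h⟩ :=
    exists_multipliers (locallyLipschitz_coord hf) hcl hg hg' hz hr hmin
  exact ⟨c, v, w, fun i => Or.inl (hv i), h⟩

end Properness

/-! ### Scaling of normals and the radial perturbation -/

section Cone

variable {E : Type*} [NormedAddCommGroup E] [InnerProductSpace ℝ E]

theorem smul_mem_regularNormalCone {S : Set E} {x v : E} {t : ℝ} (ht : 0 < t)
    (hv : v ∈ regularNormalCone S x) : t • v ∈ regularNormalCone S x := by
  intro ε hε
  filter_upwards [hv (ε / t) (div_pos hε ht)] with u hu
  rw [real_inner_smul_left]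
  calc t * inner ℝ v (u - x) ≤ t * (ε / t * ‖u - x‖) := mul_le_mul_of_nonneg_left hu ht.le
    _ = ε * ‖u - x‖ := by field_simp

theorem smul_mem_limitingNormalCone {S : Set E} {x v : E} {t : ℝ} (ht : 0 < t)
    (hv : v ∈ limitingNormalCone S x) : t • v ∈ limitingNormalCone S x := by
  obtain ⟨u, w, hu, hux, hw, hwv⟩ := hv
  exact ⟨u, fun k => t • w k, hu, hux, fun k => smul_mem_regularNormalCone ht (hw k),
    hwv.const_smul t⟩

theorem hasGradientAt_norm_sq_sub_sq [CompleteSpace E] (s : ℝ) (x : E) :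
    HasGradientAt (fun y => (‖y‖ ^ 2 - s) ^ 2) ((4 * (‖x‖ ^ 2 - s)) • x) x := by
  rw [hasGradientAt_iff_hasFDerivAt]
  have h := (((hasFDerivAt_id x).norm_sq).sub_const s).pow 2
  refine h.congr_fderiv ?_
  ext y
  simp
  ring

end Cone

/-! ### Unbounded sublevels produce forbidden sequences -/

section Converse

variable {n m : ℕ} [Nonempty (Fin m)] {f : EuclideanSpace ℝ (Fin n) → EuclideanSpace ℝ (Fin m)}
  {Ω : Set (EuclideanSpace ℝ (Fin n))}

theorem continuous_maxCoord (hf : LocallyLipschitz f) : Continuous (maxCoord f) :=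
  continuous_maxFun fun i => (locallyLipschitz_coord hf i).continuous

/-- If some sublevel set of `f|_Ω` is unbounded, there are points of `Ω` arbitrarily far away, with
values bounded above, at which `‖x‖ ν(x)` is arbitrarily small. -/
theorem exists_norm_mul_rabier_le (hf : LocallyLipschitz f) (hcl : IsClosed Ω)
    (hrec : recessionCone (f '' Ω) ∩ -nonnegOrthant m = {0}) {C : ℝ}
    (hC : ∀ R : ℝ, ∃ x ∈ Ω, (∀ i, f x i ≤ C) ∧ R < ‖x‖) {ε : ℝ} (hε : 0 < ε) (R : ℝ) :
    ∃ z ∈ Ω, (∀ i, f z i ≤ C + 1) ∧ R ≤ ‖z‖ ∧ ‖z‖ₑ * rabier f Ω z ≤ ENNReal.ofReal ε := by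
  obtain ⟨b, hb⟩ := exists_lower_bound_maxCoord hrec
  -- `sSup T` is the lower limit of `maxCoord f` at infinity along `Ω`, finite between `b` and `C`.
  set T : Set ℝ := {a | ∃ r : ℝ, ∀ x ∈ Ω, r ≤ ‖x‖ → a ≤ maxCoord f x} with hT
  have hTne : T.Nonempty := ⟨b, 0, fun x hx _ => hb x hx⟩
  have hTC : ∀ a ∈ T, a ≤ C := by
    rintro a ⟨r, hr⟩
    obtain ⟨x, hx, hxC, hxr⟩ := hC r
    exact (hr x hx hxr.le).trans (maxFun_le_iff.2 hxC)
  have hTbdd : BddAbove T := ⟨C, hTC⟩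
  set c := sSup T with hc
  have hcC : c ≤ C := csSup_le hTne hTC
  -- The final estimate is `3 / 2 * (δ * N ^ 2) = 12 * η`; the cap `1` keeps values below `C + 1`.
  set η : ℝ := min 1 (ε / 12) with hη
  have hηpos : 0 < η := lt_min one_pos (by positivity)
  have hη1 : η ≤ 1 := min_le_left _ _
  have hηε : 12 * η ≤ ε := by linarith [min_le_right (1 : ℝ) (ε / 12)]
  obtain ⟨a, ⟨r₀, hr₀⟩, hca⟩ := exists_lt_of_lt_csSup hTne (show c - η < sSup T by linarith)
  have hnot : c + η ∉ T := fun h => by linarith [le_csSup hTbdd h]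
  have hnot' : ∀ r : ℝ, ∃ x ∈ Ω, r ≤ ‖x‖ ∧ maxCoord f x < c + η := by
    intro r
    by_contra! h
    exact hnot ⟨r, h⟩
  -- The whole ball of radius `N / 2` about `x₀` then lies beyond `r₀` and `R`.
  obtain ⟨x₀, hx₀, hx₀n, hx₀f⟩ := hnot' (2 * |r₀| + 2 * |R| + 1)
  set N : ℝ := ‖x₀‖ with hN
  have hNpos : 0 < N := by linarith [abs_nonneg r₀, abs_nonneg R]
  -- On the sphere of radius `N / 2` the perturbation equals `2 * η`, more than the possible drop of
  -- `maxCoord f` from `x₀`, so the minimiser is interior.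
  set δ : ℝ := 8 * η / N ^ 2 with hδ
  have hδN : δ * N ^ 2 = 8 * η := by rw [hδ]; field_simp
  have hδpos : 0 < δ := by positivity
  have hcont : Continuous fun x => maxCoord f x + δ * ‖x - x₀‖ ^ 2 := by
    have := continuous_maxCoord hf
    fun_prop
  obtain ⟨z, ⟨hzΩ, hzball⟩, hzmin⟩ :=
    ((isCompact_closedBall x₀ (N / 2)).inter_left hcl).exists_isMinOn
      ⟨x₀, hx₀, Metric.mem_closedBall_self (by positivity)⟩ hcont.continuousOn
  have hzx : ‖z - x₀‖ ≤ N / 2 := by rwa [mem_closedBall_iff_norm] at hzball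
  have hzle : maxCoord f z + δ * ‖z - x₀‖ ^ 2 ≤ maxCoord f x₀ := by
    have h := hzmin (show x₀ ∈ Ω ∩ Metric.closedBall x₀ (N / 2) from
      ⟨hx₀, Metric.mem_closedBall_self (by positivity)⟩)
    simpa using h
  have hzN1 : N / 2 ≤ ‖z‖ := by
    have := norm_sub_norm_le x₀ z
    rw [norm_sub_rev] at this
    linarith
  have hzN2 : ‖z‖ ≤ 3 * N / 2 := by linarith [norm_sub_norm_le z x₀]
  have hza : a ≤ maxCoord f z :=
    hr₀ z hzΩ (by linarith [le_abs_self r₀, abs_nonneg R])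
  have hlt : ‖z - x₀‖ < N / 2 := by
    have h1 : δ * ‖z - x₀‖ ^ 2 < δ * (N / 2) ^ 2 := by nlinarith
    exact lt_of_pow_lt_pow_left₀ 2 (by positivity) (lt_of_mul_lt_mul_left h1 hδpos.le)
  obtain ⟨l, v, w, hv, hw, hl, hlsum, hzero⟩ := exists_multipliers_maxCoord hf hcl
    (fun x => hasGradientAt_const_mul_norm_sub_sq δ x₀ x) (by fun_prop) hzΩ (sub_pos.2 hlt)
    (fun x hx hxb => hzmin ⟨hx, by
      rw [mem_closedBall_iff_norm] at hxb ⊢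
      linarith [norm_sub_le_norm_sub_add_norm_sub x z x₀]⟩)
  refine ⟨z, hzΩ, fun i => ?_, by linarith [le_abs_self R, abs_nonneg r₀], ?_⟩
  · have h1 := le_maxFun (fun i x => f x i) z i
    have h2 : 0 ≤ δ * ‖z - x₀‖ ^ 2 := by positivity
    simp only [maxCoord] at *
    linarith
  · have h1 : rabier f Ω z ≤ ‖(∑ i, l i • v i) + w‖ₑ := sInf_le ⟨l, v, w, hv, hw, hl, hlsum, rfl⟩
    have h2 : (∑ i, l i • v i) + w = -((2 * δ) • (z - x₀)) :=
      eq_neg_of_add_eq_zero_left (by rw [← hzero]; abel)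
    refine (mul_le_mul_right h1 _).trans ?_
    rw [← ofReal_norm, ← ofReal_norm, ← ENNReal.ofReal_mul (norm_nonneg _), h2, norm_neg, norm_smul,
      Real.norm_eq_abs, abs_of_pos (by positivity)]
    refine ENNReal.ofReal_le_ofReal ?_
    calc ‖z‖ * (2 * δ * ‖z - x₀‖) ≤ 3 * N / 2 * (2 * δ * (N / 2)) := by gcongr
      _ = 3 / 2 * (δ * N ^ 2) := by ring
      _ ≤ ε := by rw [hδN]; linarith

/-- If some sublevel set of `f|_Ω` is unbounded, `Γ(f,Ω)` has points arbitrarily far away, with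
values bounded above. -/
theorem exists_mem_tangencySet (hf : LocallyLipschitz f) (hcl : IsClosed Ω)
    (hrec : recessionCone (f '' Ω) ∩ -nonnegOrthant m = {0}) {C : ℝ}
    (hC : ∀ R : ℝ, ∃ x ∈ Ω, (∀ i, f x i ≤ C) ∧ R < ‖x‖) (R : ℝ) :
    ∃ z ∈ tangencySet f Ω, (∀ i, f z i ≤ C) ∧ R ≤ ‖z‖ := by
  obtain ⟨b, hb⟩ := exists_lower_bound_maxCoord hrec
  have hbC : b ≤ C := by
    obtain ⟨x, hx, hxC, -⟩ := hC 0
    exact (hb x hx).trans (maxFun_le_iff.2 hxC)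
  -- Minimality will give `(‖z‖ ^ 2 - s) ^ 2 ≤ C - b`; this margin then yields `R ≤ ‖z‖`.
  obtain ⟨x₀, hx₀, hx₀C, hx₀n⟩ := hC (|R| + (C - b) + 1)
  have hx₀C' : maxCoord f x₀ ≤ C := maxFun_le_iff.2 hx₀C
  set s : ℝ := ‖x₀‖ ^ 2 with hs
  have hcont : Continuous fun x => maxCoord f x + (‖x‖ ^ 2 - s) ^ 2 := by
    have := continuous_maxCoord hf
    fun_prop
  have hx₀K : x₀ ∈ Ω ∩ Metric.closedBall 0 (‖x₀‖ + (C - b) + 1) := by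
    refine ⟨hx₀, mem_closedBall_zero_iff.2 ?_⟩
    linarith
  obtain ⟨z, ⟨hzΩ, -⟩, hzmin⟩ :=
    ((isCompact_closedBall 0 (‖x₀‖ + (C - b) + 1)).inter_left hcl).exists_isMinOn
      ⟨x₀, hx₀K⟩ hcont.continuousOn
  have hzle : maxCoord f z + (‖z‖ ^ 2 - s) ^ 2 ≤ maxCoord f x₀ := by
    have h := hzmin hx₀K
    simpa [hs] using h
  -- Outside the ball the perturbation alone exceeds `C - b`, so the minimum is global.
  have hglob : ∀ x ∈ Ω, maxCoord f z + (‖z‖ ^ 2 - s) ^ 2 ≤ maxCoord f x + (‖x‖ ^ 2 - s) ^ 2 := by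
    intro x hx
    by_cases hxb : ‖x‖ ≤ ‖x₀‖ + (C - b) + 1
    · exact hzmin ⟨hx, mem_closedBall_zero_iff.2 hxb⟩
    · have h1 : C - b + 1 ≤ ‖x‖ ^ 2 - s := by
        rw [hs]
        nlinarith [norm_nonneg x₀, abs_nonneg R]
      nlinarith [hb x hx]
  have hzb := hb z hzΩ
  have hzR : R ≤ ‖z‖ := by
    have h1 : s - (C - b) - 1 ≤ ‖z‖ ^ 2 := by
      by_contra! h
      nlinarith
    have h2 : |R| ^ 2 ≤ ‖z‖ ^ 2 := by
      rw [hs] at h1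
      nlinarith [abs_nonneg R, norm_nonneg x₀]
    exact (le_abs_self R).trans (le_of_sq_le_sq h2 (norm_nonneg z))
  obtain ⟨l, v, w, hv, hw, hl, hlsum, hzero⟩ := exists_multipliers_maxCoord hf hcl
    (fun x => hasGradientAt_norm_sq_sub_sq s x) (by fun_prop) hzΩ one_pos
    (fun x hx _ => hglob x hx)
  set μ : ℝ := 4 * (‖z‖ ^ 2 - s) with hμ
  have hpos : 0 < 1 + |μ| := by positivity
  -- Dividing by `1 + |μ|` passes from `∑ l = 1` to the normalisation in `Γ`; normals form a cone.
  refine ⟨z, ⟨hzΩ, v, fun i => (1 + |μ|)⁻¹ * l i, (1 + |μ|)⁻¹ * μ, (1 + |μ|)⁻¹ • w, hv,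
    fun i => mul_nonneg (inv_pos.2 hpos).le (hl i), ?_,
    smul_mem_limitingNormalCone (inv_pos.2 hpos) hw, ?_⟩, fun i => ?_, hzR⟩
  · rw [← Finset.mul_sum, hlsum, abs_mul _ μ, abs_of_pos (inv_pos.2 hpos), ← mul_add,
      inv_mul_cancel₀ hpos.ne']
  · simp only [mul_smul]
    rw [← Finset.smul_sum, ← smul_add, ← smul_add, hzero, smul_zero]
  · have h1 := le_maxFun (fun i x => f x i) z i
    have h2 := sq_nonneg (‖z‖ ^ 2 - s)
    simp only [maxCoord] at *
    linarith

theorem hasBoundedSublevels_of_weakPalaisSmale (hf : LocallyLipschitz f) (hcl : IsClosed Ω)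
    (hrec : recessionCone (f '' Ω) ∩ -nonnegOrthant m = {0}) (h : WeakPalaisSmale f Ω) :
    HasBoundedSublevels f Ω := by
  intro C
  by_contra! hC
  choose z hzΩ hzC hzn hzν using fun k : ℕ => exists_norm_mul_rabier_le hf hcl hrec hC
    (ε := 1 / ((k : ℝ) + 1)) (by positivity) k
  obtain ⟨y, φ, hφ, hlim⟩ := exists_subseq_tendsto_values hrec hzΩ hzC
  refine Set.notMem_empty y (h ▸ ⟨fun k => z (φ k), fun k => hzΩ _, fun _ _ => le_top, ?_, hlim, ?_⟩)
  · exact (tendsto_atTop_mono hzn tendsto_natCast_atTop_atTop).comp hφ.tendsto_atTop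
  · have h1 : Tendsto (fun k : ℕ => ENNReal.ofReal (1 / ((k : ℝ) + 1))) atTop (𝓝 0) := by
      simpa using ENNReal.tendsto_ofReal tendsto_one_div_add_atTop_nhds_zero_nat
    exact (tendsto_of_tendsto_of_tendsto_of_le_of_le tendsto_const_nhds h1 (fun _ => zero_le)
      hzν).comp hφ.tendsto_atTop

theorem hasBoundedSublevels_of_mTame (hf : LocallyLipschitz f) (hcl : IsClosed Ω)
    (hrec : recessionCone (f '' Ω) ∩ -nonnegOrthant m = {0}) (h : MTame f Ω) :
    HasBoundedSublevels f Ω := by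
  intro C
  by_contra! hC
  choose z hzΓ hzC hzn using fun k : ℕ => exists_mem_tangencySet hf hcl hrec hC k
  obtain ⟨y, φ, hφ, hlim⟩ := exists_subseq_tendsto_values hrec (fun k => (hzΓ k).1) hzC
  exact Set.notMem_empty y (h ▸ ⟨fun k => z (φ k), fun k => hzΓ _, fun _ _ => le_top,
    (tendsto_atTop_mono hzn tendsto_natCast_atTop_atTop).comp hφ.tendsto_atTop, hlim⟩)

/-! ### Existence of properly efficient points -/

/-- Minimisers over `Ω` of `max fᵢ + ρ ∑ fᵢ`, `ρ > 0`, are Geoffrion-properly efficient. -/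
theorem isGeoffrionProperlyEfficient_of_isMinOn {ρ : ℝ} (hρ : 0 < ρ)
    {xbar : EuclideanSpace ℝ (Fin n)} (hxbar : xbar ∈ Ω)
    (hmin : ∀ x ∈ Ω, maxCoord f xbar + ρ * ∑ j, f xbar j ≤ maxCoord f x + ρ * ∑ j, f x j) :
    IsGeoffrionProperlyEfficient f Ω xbar := by
  have hm : (0 : ℝ) < m := by exact_mod_cast Fin.pos (Classical.arbitrary (Fin m))
  have key : ∀ x ∈ Ω, ∀ i, f x i < f xbar i → ∃ j, f xbar j < f x j ∧
      ρ * (f xbar i - f x i) ≤ (1 + ρ * m) * (f x j - f xbar j) := by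
    intro x hx i hi
    -- The largest increment must be positive by minimality, and it dominates every other term,
    -- hence bounds the decrease in `i`.
    obtain ⟨j, -, hj⟩ := Finset.exists_max_image Finset.univ (fun j => f x j - f xbar j)
      ⟨i, Finset.mem_univ i⟩
    have hj' : ∀ k, f x k - f xbar k ≤ f x j - f xbar j := fun k => hj k (Finset.mem_univ k)
    have h1 : maxCoord f x ≤ maxCoord f xbar + (f x j - f xbar j) :=
      maxFun_le_iff.2 fun k => by linarith [hj' k, le_maxFun (fun i x => f x i) xbar k]
    have h2 := hmin x hx
    have h3 : ∑ k, (f x k - f xbar k) = ∑ k, f x k - ∑ k, f xbar k := Finset.sum_sub_distrib _ _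
    have h4 : 0 ≤ (f x j - f xbar j) + ρ * ∑ k, (f x k - f xbar k) := by
      rw [h3]
      linarith
    have hjpos : 0 < f x j - f xbar j := by
      by_contra! hneg
      have h5 : ∑ k, (f x k - f xbar k) < 0 :=
        Finset.sum_neg' (fun k _ => (hj' k).trans hneg) ⟨i, Finset.mem_univ i, by linarith⟩
      nlinarith
    refine ⟨j, by linarith, ?_⟩
    have h6 : ∑ k ∈ Finset.univ.erase i, (f x k - f xbar k) ≤ m * (f x j - f xbar j) := by
      calc _ ≤ ∑ _k ∈ Finset.univ.erase i, (f x j - f xbar j) :=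
            Finset.sum_le_sum fun k _ => hj' k
        _ ≤ ∑ _k : Fin m, (f x j - f xbar j) :=
            Finset.sum_le_sum_of_subset_of_nonneg (Finset.erase_subset _ _) fun _ _ _ => hjpos.le
        _ = m * (f x j - f xbar j) := by rw [Finset.sum_const, Finset.card_univ,
            Fintype.card_fin, nsmul_eq_mul]
    rw [← Finset.add_sum_erase _ _ (Finset.mem_univ i)] at h4
    nlinarith
  refine ⟨⟨hxbar, ?_⟩, (1 + ρ * m) / ρ, by positivity, fun i x hx hi => ?_⟩
  · rintro ⟨x, hx, hle, hne⟩
    obtain ⟨i, hi⟩ : ∃ i, f x i ≠ f xbar i := by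
      by_contra! h
      exact hne (PiLp.ext h)
    obtain ⟨j, hj, -⟩ := key x hx i (lt_of_le_of_ne (hle i) hi)
    exact absurd (hle j) (not_le.2 hj)
  · obtain ⟨j, hj, h⟩ := key x hx i hi
    refine ⟨j, hj, ?_⟩
    rw [div_le_div_iff₀ (sub_pos.2 hj) hρ]
    linarith

/-- Augmented sublevels have bounded values by choice of `ρ`, hence bounded points, so a minimiser
exists by compactness. -/
theorem exists_isGeoffrionProperlyEfficient (hf : LocallyLipschitz f) (hne : Ω.Nonempty)
    (hcl : IsClosed Ω) (hrec : recessionCone (f '' Ω) ∩ -nonnegOrthant m = {0})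
    (h : HasBoundedSublevels f Ω) : ∃ xbar, IsGeoffrionProperlyEfficient f Ω xbar := by
  obtain ⟨ρ, hρ, hbd⟩ := exists_bounded_augmented_sublevels hrec
  obtain ⟨x₀, hx₀⟩ := hne
  have hcont : Continuous fun x => maxCoord f x + ρ * ∑ j, f x j :=
    (continuous_maxCoord hf).add (continuous_const.mul
      (continuous_finsetSum _ fun j _ => (locallyLipschitz_coord hf j).continuous))
  set a := maxCoord f x₀ + ρ * ∑ j, f x₀ j with ha
  obtain ⟨R, hR⟩ := hbd a
  obtain ⟨R', hR'⟩ := h R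
  have hbound : ∀ x ∈ Ω, maxCoord f x + ρ * ∑ j, f x j ≤ a → ‖x‖ ≤ R' := fun x hx hxa =>
    hR' x hx fun i => (le_abs_self _).trans <| (PiLp.norm_apply_le (f x) i).trans <|
      hR _ ⟨x, hx, rfl⟩ fun i =>
        (add_le_add_left (le_maxFun (fun i x => f x i) x i) _).trans hxa
  have hx₀K : x₀ ∈ Ω ∩ Metric.closedBall 0 R' :=
    ⟨hx₀, mem_closedBall_zero_iff.2 (hbound x₀ hx₀ le_rfl)⟩
  obtain ⟨xbar, hxbar, hmin⟩ := ((isCompact_closedBall 0 R').inter_left hcl).exists_isMinOn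
    ⟨x₀, hx₀K⟩ hcont.continuousOn
  refine ⟨xbar, isGeoffrionProperlyEfficient_of_isMinOn hρ hxbar.1 fun x hx => ?_⟩
  by_cases hxa : maxCoord f x + ρ * ∑ j, f x j ≤ a
  · exact hmin ⟨hx, mem_closedBall_zero_iff.2 (hbound x hx hxa)⟩
  · exact (hmin hx₀K).trans (not_le.1 hxa).le

end Converse

end VectorOpt

theorem theorem4p2 {n m : ℕ} (hm : 0 < m)
    (f : EuclideanSpace ℝ (Fin n) → EuclideanSpace ℝ (Fin m)) (hf : LocallyLipschitz f)
    (Ω : Set (EuclideanSpace ℝ (Fin n))) (hne : Ω.Nonempty) (hcl : IsClosed Ω)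
    (hrec : VectorOpt.recessionCone (f '' Ω) ∩ -VectorOpt.nonnegOrthant m = {0}) :
    List.TFAE [VectorOpt.IsProperOn f Ω, VectorOpt.PalaisSmale f Ω,
      VectorOpt.WeakPalaisSmale f Ω, VectorOpt.MTame f Ω] ∧
    (VectorOpt.IsProperOn f Ω ∨ VectorOpt.PalaisSmale f Ω ∨
      VectorOpt.WeakPalaisSmale f Ω ∨ VectorOpt.MTame f Ω →
        ∃ xbar, VectorOpt.IsGeoffrionProperlyEfficient f Ω xbar) := by
  have : Nonempty (Fin m) := ⟨⟨0, hm⟩⟩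
  have htfae : List.TFAE [VectorOpt.IsProperOn f Ω, VectorOpt.PalaisSmale f Ω,
      VectorOpt.WeakPalaisSmale f Ω, VectorOpt.MTame f Ω] := by
    tfae_have 1 → 2 := fun h =>
      VectorOpt.palaisSmale_of_hasBoundedSublevels (VectorOpt.hasBoundedSublevels_of_isProperOn hrec h)
    tfae_have 2 → 3 := VectorOpt.weakPalaisSmale_of_palaisSmale
    tfae_have 3 → 1 := fun h => VectorOpt.isProperOn_of_hasBoundedSublevels
      (VectorOpt.hasBoundedSublevels_of_weakPalaisSmale hf hcl hrec h)
    tfae_have 1 → 4 := fun h =>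
      VectorOpt.mTame_of_hasBoundedSublevels (VectorOpt.hasBoundedSublevels_of_isProperOn hrec h)
    tfae_have 4 → 1 := fun h => VectorOpt.isProperOn_of_hasBoundedSublevels
      (VectorOpt.hasBoundedSublevels_of_mTame hf hcl hrec h)
    tfae_finish
  refine ⟨htfae, fun h => ?_⟩
  have hproper : VectorOpt.IsProperOn f Ω := by
    rcases h with h | h | h | h
    · exact h
    · exact (htfae.out 0 1).2 h
    · exact (htfae.out 0 2).2 h
    · exact (htfae.out 0 3).2 h
  exact VectorOpt.exists_isGeoffrionProperlyEfficient hf hne hcl hrec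
    (VectorOpt.hasBoundedSublevels_of_isProperOn hrec hproper)
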